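/- **Theorem 3.1.** Let $n\ge 1$, let $\mathcal S_n$ be the set of permutations $\pi=\pi_1\pi_2\cdots\pi_n$ (in one-line notation) of $[n]=\{1,\dots,n\}$, and let $\theta:\mathcal S_n\to\mathcal S_n$ be the fundamental bijection: write $\pi$ as a product of disjoint cycles (fixed points included), each cycle $(m,\pi(m),\pi(\pi(m)),\dots)$ beginning with its largest element $m$ and the cycles ordered increasingly by their largest elements; removing the parentheses gives the one-line notation of $\theta(\pi)$. A permutation of $[n]$ is *cyclic* if it consists of a single cycle on all of $[n]$, and it *avoids* $321$ if there are no $i<j<k$ with $\pi_i>\pi_j>\pi_k$. A *vincular pattern* is a permutation $\sigma=\sigma_1\cdots\sigma_k$ with some blocks of consecutive entries underbracketed. A permutation $\tau\in\mathcal S_n$ *contains* it if there are $i_1<\dots<i_k$ such that $\tau_{i_1}\cdots\tau_{i_k}$ is in the same relative order as $\sigma$; $i_{r+1}=i_r+1$ whenever $\sigma_r$ and $\sigma_{r+1}$ lie under the same bracket; $i_1=1$ if $\sigma_1$ has a bracket of its own; and $i_k=n$ if $\sigma_k$ has a bracket of its own. Otherwise $\tau$ *avoids* the pattern. Let $$P=\{\underbracket{32}\,\underbracket{41},\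 \underbracket{14}\,\underbracket{23},\ \underbracket{41}\,\underbracket{32},\ \underbracket{23}\,\underbracket{14},\ \underbracket{23}\,\underbracket{1}\}.$$ Then for every $\pi\in\mathcal S_n$: $\pi$ is cyclic and avoids $321$ if and only if $\theta(\pi)_1=n$ and $\theta(\pi)$ avoids every pattern in $P$. Equivalently, $$\mathcal C_n(321)=\theta^{-1}\big(\mathcal S_{n,n}(P)\big),$$ where $\mathcal C_n(321)$ is the set of cyclic permutations of $[n]$ avoiding $321$ and $\mathcal S_{n,n}(P)$ is the set of $\tau\in\mathcal S_n$ with $\tau_1=n$ that avoid every pattern in $P$. -/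

import Mathlib

/- A permutation of `[n]` is an element of `Equiv.Perm (Fin n)`; the entry `i` of `[n]` is the
element of `Fin n` with value `i - 1`, and `π = π_1 ⋯ π_n` in one-line notation, with `π_{i+1}`
the entry represented by `π i`. -/

namespace CyclicAvoidance

/-! ### Standard cycle notation and the fundamental bijection -/

/-- The cycle of `π` through `x`, written as `x, π x, π (π x), …`; a fixed point gives `[x]`. -/
def cycleFrom {n : ℕ} (π : Equiv.Perm (Fin n)) (x : Fin n) : List (Fin n) :=
  if π x = x then [x] else π.toList x

/-- The elements that are largest in their cycle (fixed points included), in increasing order. -/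
def cycleMaxima {n : ℕ} (π : Equiv.Perm (Fin n)) : List (Fin n) :=
  (List.finRange n).filter (fun m => ∀ y, π.SameCycle m y → y ≤ m)

/-- The standard cycle notation: each cycle is written with its largest element first, and the
cycles (fixed points included) are ordered increasingly by their largest element. -/
def standardCycleNotation {n : ℕ} (π : Equiv.Perm (Fin n)) : List (List (Fin n)) :=
  (cycleMaxima π).map (cycleFrom π)

/-- The word obtained by removing the parentheses from the standard cycle notation. -/
def thetaWord {n : ℕ} (π : Equiv.Perm (Fin n)) : List (Fin n) :=
  (standardCycleNotation π).flatten

theorem mem_cycleFrom {n : ℕ} (π : Equiv.Perm (Fin n)) (x y : Fin n) :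
    y ∈ cycleFrom π x ↔ π.SameCycle x y := by
  unfold cycleFrom
  split_ifs with h
  · rw [List.mem_singleton]
    constructor
    · rintro rfl; exact Equiv.Perm.SameCycle.refl _ _
    · intro hs; exact (hs.eq_of_left h).symm
  · rw [Equiv.Perm.mem_toList_iff]
    exact ⟨fun h' => h'.1, fun h' => ⟨h', by simpa using h⟩⟩

theorem nodup_cycleFrom {n : ℕ} (π : Equiv.Perm (Fin n)) (x : Fin n) :
    (cycleFrom π x).Nodup := by
  unfold cycleFrom
  split_ifs with h
  · exact List.nodup_singleton x
  · exact Equiv.Perm.nodup_toList π x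

theorem mem_cycleMaxima {n : ℕ} (π : Equiv.Perm (Fin n)) (m : Fin n) :
    m ∈ cycleMaxima π ↔ ∀ y, π.SameCycle m y → y ≤ m := by
  simp [cycleMaxima]

theorem mem_thetaWord {n : ℕ} (π : Equiv.Perm (Fin n)) (x : Fin n) : x ∈ thetaWord π := by
  classical
  obtain ⟨m, hm, hmax⟩ := Finset.exists_max_image
    (Finset.univ.filter (fun y => π.SameCycle x y)) id
    ⟨x, by simpa using Equiv.Perm.SameCycle.refl π x⟩
  simp only [Finset.mem_filter, Finset.mem_univ, true_and, id] at hm hmax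
  simp only [thetaWord, standardCycleNotation, List.mem_flatten, List.mem_map]
  exact ⟨_, ⟨m, (mem_cycleMaxima π m).2 fun y hy => hmax y (hm.trans hy), rfl⟩,
    (mem_cycleFrom π m x).2 hm.symm⟩

theorem nodup_thetaWord {n : ℕ} (π : Equiv.Perm (Fin n)) : (thetaWord π).Nodup := by
  unfold thetaWord standardCycleNotation
  rw [List.nodup_flatten]
  constructor
  · intro l hl
    obtain ⟨m, -, rfl⟩ := List.mem_map.1 hl
    exact nodup_cycleFrom π m
  · rw [List.pairwise_map]
    have hnd : (cycleMaxima π).Nodup := (List.nodup_finRange n).filter _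
    refine List.Pairwise.imp_of_mem ?_ hnd
    intro a b ha hb hab x hxa hxb
    rw [mem_cycleFrom] at hxa hxb
    have h : π.SameCycle a b := hxa.trans hxb.symm
    exact hab (le_antisymm ((mem_cycleMaxima π b).1 hb a h.symm)
      ((mem_cycleMaxima π a).1 ha b h))

theorem length_thetaWord {n : ℕ} (π : Equiv.Perm (Fin n)) : n = (thetaWord π).length := by
  have h := Fintype.card_congr
    ((nodup_thetaWord π).getEquivOfForallMemList (thetaWord π) (mem_thetaWord π))
  simpa using h.symm

/-- The fundamental bijection: `theta π` is the permutation whose one-line notation is the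
standard cycle notation of `π` with its parentheses removed. -/
def theta {n : ℕ} (π : Equiv.Perm (Fin n)) : Equiv.Perm (Fin n) :=
  (finCongr (length_thetaWord π)).trans
    ((nodup_thetaWord π).getEquivOfForallMemList (thetaWord π) (mem_thetaWord π))

/-! ### Pattern containment -/

/-- The entries of `π` at the positions `f 0 < f 1 < ⋯` are order isomorphic to the word `w`. -/
def OrderIsomorphicAt {n k : ℕ} (π : Equiv.Perm (Fin n)) (w : Fin k → ℕ)
    (f : Fin k ↪o Fin n) : Prop :=
  ∀ r s : Fin k, π (f r) < π (f s) ↔ w r < w s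

/-- `π` avoids the classical pattern with one-line notation `w`. -/
def AvoidsClassical {n k : ℕ} (π : Equiv.Perm (Fin n)) (w : Fin k → ℕ) : Prop :=
  ¬ ∃ f : Fin k ↪o Fin n, OrderIsomorphicAt π w f

/-- A vincular pattern: a permutation of `{1, …, length}` in one-line notation, together with
the underbrackets, each given by the set of the positions (counted from `0`) that it covers. -/
structure VincularPattern where
  length : ℕ
  word : Fin length → ℕ
  isPerm : Finset.univ.image word = Finset.Icc 1 length
  brackets : Finset (Finset (Fin length))

/-- `π` contains the vincular pattern `p`: some subsequence of `π` is order isomorphic to the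
word of `p`, entries in neighbouring positions under a common bracket are adjacent in `π`, and if
the first (last) entry of the pattern has a bracket of its own then the corresponding entry is
the first (last) entry of `π`. -/
def VincularPattern.ContainedIn {n : ℕ} (p : VincularPattern) (π : Equiv.Perm (Fin n)) : Prop :=
  ∃ f : Fin p.length ↪o Fin n, OrderIsomorphicAt π p.word f ∧
    (∀ B ∈ p.brackets, ∀ i ∈ B, ∀ j ∈ B, j.val = i.val + 1 → (f j).val = (f i).val + 1) ∧
    (∀ i : Fin p.length, {i} ∈ p.brackets → i.val = 0 → (f i).val = 0) ∧
    (∀ i : Fin p.length, {i} ∈ p.brackets → i.val + 1 = p.length → (f i).val + 1 = n)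

/-- The pattern with brackets `32` and `41`. -/
def pat32_41 : VincularPattern where
  length := 4
  word := ![3, 2, 4, 1]
  isPerm := by decide
  brackets := {{0, 1}, {2, 3}}

/-- The pattern with brackets `14` and `23`. -/
def pat14_23 : VincularPattern where
  length := 4
  word := ![1, 4, 2, 3]
  isPerm := by decide
  brackets := {{0, 1}, {2, 3}}

/-- The pattern with brackets `41` and `32`. -/
def pat41_32 : VincularPattern where
  length := 4
  word := ![4, 1, 3, 2]
  isPerm := by decide
  brackets := {{0, 1}, {2, 3}}

/-- The pattern with brackets `23` and `14`. -/
def pat23_14 : VincularPattern where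
  length := 4
  word := ![2, 3, 1, 4]
  isPerm := by decide
  brackets := {{0, 1}, {2, 3}}

/-- The pattern with brackets `23` and `1`; the entry `1` has to be the final entry. -/
def pat23_1 : VincularPattern where
  length := 3
  word := ![2, 3, 1]
  isPerm := by decide
  brackets := {{0, 1}, {2}}

/-- The set of the five patterns. -/
def fivePatterns : Set VincularPattern :=
  {pat32_41, pat14_23, pat41_32, pat23_14, pat23_1}

/-! ### Sets of permutations -/

/-- `π` is cyclic: its cycle form, fixed points included, is a single cycle on all of `[n]`. -/
def Cyclic {n : ℕ} (π : Equiv.Perm (Fin n)) : Prop :=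
  π.IsCycleOn Set.univ

/-- `C_n(w)`: the cyclic permutations of `[n]` that avoid the classical pattern `w`. -/
def cyclicAvoiders (n : ℕ) {k : ℕ} (w : Fin k → ℕ) : Set (Equiv.Perm (Fin n)) :=
  {π | Cyclic π ∧ AvoidsClassical π w}

/-- The first entry of `π` (with values in `{1, …, n}`) is `k`. -/
def StartsWith {n : ℕ} (π : Equiv.Perm (Fin n)) (k : ℕ) : Prop :=
  ∃ h : 0 < n, (π ⟨0, h⟩).val + 1 = k

/-- `S_{n,k}(P)`: the permutations of `[n]` that start with `k` and avoid every vincular pattern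
in `P`. -/
def startingAvoiders (n k : ℕ) (P : Set VincularPattern) : Set (Equiv.Perm (Fin n)) :=
  {π | StartsWith π k ∧ ∀ p ∈ P, ¬ p.ContainedIn π}

end CyclicAvoidance

namespace CyclicAvoidance

open Equiv.Perm

variable {m : ℕ}

/-! ### The fundamental bijection on cyclic permutations -/

/-! For cyclic `π` the word `theta π` is n, π(n), π²(n), …, so its adjacent entries are exactly the
arcs x → π(x), except for the closing arc from the last entry back to n. In a cyclic permutation the
middle letter b of a 321 is not fixed. If b < π(b), then b and the first letter a give nested arcs a
< b < π(b) < π(a); if π(b) < b, the last letter gives the mirror image. Conversely, pigeonhole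
completes any nested pair to a 321 (`exists_321_iff_of_cyclic`).

Nested arcs have four distinct ends, so in `theta π` they are disjoint adjacent pairs: two
directions and two orders of appearance give the four patterns of length 4. The closing arc ends at
n, so it can only be the outer arc of a rising pair; this gives the pattern of length 3. -/

theorem theta_apply {n : ℕ} (π : Equiv.Perm (Fin n)) (i : Fin n) :
    theta π i = (thetaWord π)[i.val]'(by rw [← length_thetaWord π]; exact i.2) := rfl

theorem getElem_cycleFrom {n : ℕ} (π : Equiv.Perm (Fin n)) (x : Fin n) (i : ℕ)
    (hi : i < (cycleFrom π x).length) : (cycleFrom π x)[i] = (π ^ i) x := by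
  unfold cycleFrom at hi ⊢
  split_ifs with h
  · simp only [h, if_true, List.length_singleton] at hi
    obtain rfl : i = 0 := by omega
    simp
  · exact Equiv.Perm.getElem_toList ..

theorem cycleFrom_eq_cons {n : ℕ} (π : Equiv.Perm (Fin n)) (x : Fin n) :
    ∃ l, cycleFrom π x = x :: l := by
  have hx : x ∈ cycleFrom π x := (mem_cycleFrom π x x).2 (SameCycle.refl π x)
  have h0 := getElem_cycleFrom π x 0 (List.length_pos_of_mem hx)
  cases h : cycleFrom π x with
  | nil => simp [h] at hx
  | cons y l => exact ⟨l, by simp [h] at h0; rw [h0]⟩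

theorem cycleMaxima_eq_of_cyclic {π : Equiv.Perm (Fin (m + 1))} (h : Cyclic π) :
    cycleMaxima π = [Fin.last m] := by
  have hnd : (cycleMaxima π).Nodup := (List.nodup_finRange _).filter _
  have hmem : ∀ x, x ∈ cycleMaxima π ↔ x = Fin.last m := fun x => by
    rw [mem_cycleMaxima]
    constructor
    · intro hx
      exact le_antisymm (Fin.le_last x) (hx _ (h.2 (Set.mem_univ _) (Set.mem_univ _)))
    · rintro rfl y -
      exact Fin.le_last y
  exact List.perm_singleton.1 ((List.perm_ext_iff_of_nodup hnd (List.nodup_singleton _)).2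
    fun x => by rw [hmem, List.mem_singleton])

theorem theta_apply_of_cyclic {π : Equiv.Perm (Fin (m + 1))} (h : Cyclic π) (i : Fin (m + 1)) :
    theta π i = (π ^ i.val) (Fin.last m) := by
  have hw : thetaWord π = cycleFrom π (Fin.last m) := by
    simp [thetaWord, standardCycleNotation, cycleMaxima_eq_of_cyclic h]
  rw [theta_apply]
  simp only [hw]
  exact getElem_cycleFrom ..

/-- The word begins with the smallest cycle maximum; if that is already the top element, no second
cycle exists. -/
theorem startsWith_theta_iff (π : Equiv.Perm (Fin (m + 1))) :
    StartsWith (theta π) (m + 1) ↔ Cyclic π := by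
  constructor
  · rintro ⟨h0, h1⟩
    have hlast : theta π ⟨0, h0⟩ = Fin.last m := Fin.ext (by simpa using h1)
    have hpw : (cycleMaxima π).Pairwise (· < ·) :=
      (List.pairwise_lt_finRange _).filter _
    rw [theta_apply] at hlast
    cases hc : cycleMaxima π with
    | nil => simpa [thetaWord, standardCycleNotation, hc] using mem_thetaWord π 0
    | cons y l =>
      obtain ⟨l', hl'⟩ := cycleFrom_eq_cons π y
      have hy : y = Fin.last m := by
        simpa [thetaWord, standardCycleNotation, hc, hl'] using hlast
      have hl : l = [] := by
        rw [hc, List.pairwise_cons] at hpw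
        refine List.eq_nil_iff_forall_not_mem.2 fun z hz => ?_
        exact absurd (hpw.1 z hz) (by rw [hy]; exact not_lt.2 (Fin.le_last z))
      have hs : ∀ x, π.SameCycle (Fin.last m) x := fun x => by
        have := mem_thetaWord π x
        simp only [thetaWord, standardCycleNotation, hc, hl, hy, List.map_cons, List.map_nil,
          List.flatten_cons, List.flatten_nil, List.append_nil] at this
        exact (mem_cycleFrom ..).1 this
      exact ⟨Set.bijOn_univ.2 π.bijective, fun x _ y _ => (hs x).symm.trans (hs y)⟩
  · intro h
    refine ⟨Nat.succ_pos m, ?_⟩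
    rw [theta_apply_of_cyclic h]
    simp

theorem theta_zero_of_cyclic {π : Equiv.Perm (Fin (m + 1))} (h : Cyclic π) :
    theta π 0 = Fin.last m := by
  simp [theta_apply_of_cyclic h]

theorem apply_theta_of_cyclic {π : Equiv.Perm (Fin (m + 1))} (h : Cyclic π)
    {i j : Fin (m + 1)} (hij : j.val = i.val + 1) : π (theta π i) = theta π j := by
  rw [theta_apply_of_cyclic h, theta_apply_of_cyclic h, hij, pow_succ', Equiv.Perm.mul_apply]

/-- The closing arc. Every other entry of the word is already the image of its predecessor, so
injectivity leaves only the first entry. -/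
theorem apply_theta_last_of_cyclic {π : Equiv.Perm (Fin (m + 1))} (h : Cyclic π) :
    π (theta π (Fin.last m)) = Fin.last m := by
  obtain ⟨j, hj⟩ := (theta π).surjective (π (theta π (Fin.last m)))
  rcases Fin.eq_zero_or_eq_succ j with rfl | ⟨k, rfl⟩
  · rw [← hj, theta_zero_of_cyclic h]
  · rw [← apply_theta_of_cyclic h (i := k.castSucc) (by simp)] at hj
    exact absurd ((theta π).injective (π.injective hj)) (Fin.castSucc_lt_last k).ne

/-- The second point `a` rules out the one-element cycle, which is a fixed point. -/
theorem apply_ne_of_cyclic {π : Equiv.Perm (Fin (m + 1))} (h : Cyclic π) {a b : Fin (m + 1)}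
    (hab : a ≠ b) : π b ≠ b := fun hb =>
  hab ((h.2 (Set.mem_univ b) (Set.mem_univ a)).eq_of_left hb).symm

/-! ### Occurrences of 321 and nested arcs -/

theorem orderIsomorphicAt_321_iff {n : ℕ} (π : Equiv.Perm (Fin n)) :
    (∃ f : Fin 3 ↪o Fin n, OrderIsomorphicAt π ![3, 2, 1] f) ↔
      ∃ a b c, a < b ∧ b < c ∧ π b < π a ∧ π c < π b := by
  constructor
  · rintro ⟨f, hf⟩
    exact ⟨f 0, f 1, f 2, f.strictMono (by decide), f.strictMono (by decide),
      (hf 1 0).2 (by decide), (hf 2 1).2 (by decide)⟩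
  · rintro ⟨a, b, c, hab, hbc, h1, h2⟩
    refine ⟨OrderEmbedding.ofStrictMono ![a, b, c] ?_, ?_⟩
    · rw [Fin.strictMono_iff_lt_succ]
      intro i
      fin_cases i <;> simpa
    · intro r s
      fin_cases r <;> fin_cases s <;> simp <;> order

/-- A nested pair of excedances is the beginning of an occurrence of 321. -/
theorem exists_lt_apply_of_nested {n : ℕ} (π : Equiv.Perm (Fin n)) {a b : Fin n} (hab : a < b)
    (hb : b < π b) (hba : π b < π a) : ∃ c, b < c ∧ π c < π b := by
  by_contra! hc
  -- Pigeonhole: without such a `c`, all values below `π b` sit at positions before `b` other than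
  -- `a`, which forces `π b ≤ b - 1`.
  have hsub : (Finset.Iio (π b)).map π.symm.toEmbedding ⊆ (Finset.Iio b).erase a := by
    intro x hx
    obtain ⟨y, hy, rfl⟩ := Finset.mem_map.1 hx
    rw [Finset.mem_Iio] at hy
    simp only [Equiv.coe_toEmbedding, Finset.mem_erase, Finset.mem_Iio]
    refine ⟨?_, lt_of_not_ge fun hle => ?_⟩
    · rintro rfl
      simp only [Equiv.apply_symm_apply] at hba
      exact lt_asymm hba hy
    · rcases hle.eq_or_lt with heq | hlt
      · rw [heq, Equiv.apply_symm_apply] at hy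
        exact lt_irrefl _ hy
      · have := hc _ hlt
        rw [Equiv.apply_symm_apply] at this
        exact absurd hy (not_lt.2 this)
  have hcard := Finset.card_le_card hsub
  rw [Finset.card_map, Finset.card_erase_of_mem (Finset.mem_Iio.2 hab), Fin.card_Iio,
    Fin.card_Iio] at hcard
  rw [Fin.lt_def] at hb
  omega

/-- A nested pair of anti-excedances is the end of an occurrence of 321. -/
theorem exists_gt_apply_of_nested {n : ℕ} (π : Equiv.Perm (Fin n)) {b c : Fin n} (hbc : b < c)
    (hb : π b < b) (hcb : π c < π b) : ∃ a, a < b ∧ π b < π a := by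
  -- Reversing positions and values turns anti-excedances into excedances and preserves nesting.
  let ρ : Equiv.Perm (Fin n) := (Fin.revPerm.trans π).trans Fin.revPerm
  have hρ : ∀ x, ρ x = (π x.rev).rev := fun _ => rfl
  obtain ⟨a, ha, ha'⟩ := exists_lt_apply_of_nested ρ (a := c.rev) (b := b.rev)
    (Fin.rev_lt_rev.2 hbc) (by simpa [hρ] using hb) (by simpa [hρ] using hcb)
  refine ⟨a.rev, Fin.rev_lt_iff.1 ha, ?_⟩
  simpa [hρ] using ha'

theorem exists_321_iff_of_cyclic {π : Equiv.Perm (Fin (m + 1))} (h : Cyclic π) :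
    (∃ a b c, a < b ∧ b < c ∧ π b < π a ∧ π c < π b) ↔
      (∃ a b, a < b ∧ b < π b ∧ π b < π a) ∨ ∃ b c, b < c ∧ π b < b ∧ π c < π b := by
  constructor
  · rintro ⟨a, b, c, hab, hbc, h1, h2⟩
    rcases lt_or_gt_of_ne (apply_ne_of_cyclic h hab.ne) with hb | hb
    · exact .inr ⟨b, c, hbc, hb, h2⟩
    · exact .inl ⟨a, b, hab, hb, h1⟩
  · rintro (⟨a, b, hab, hb, hba⟩ | ⟨b, c, hbc, hb, hcb⟩)
    · obtain ⟨c, hc, hc'⟩ := exists_lt_apply_of_nested π hab hb hba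
      exact ⟨a, b, c, hab, hc, hba, hc'⟩
    · obtain ⟨a, ha, ha'⟩ := exists_gt_apply_of_nested π hbc hb hcb
      exact ⟨a, b, c, ha, hbc, ha', hcb⟩

/-! ### Occurrences of the vincular patterns -/

/-- Handles at once the four patterns of length 4, which differ only in their word. -/
theorem containedIn_pairs_iff {n : ℕ} (τ : Equiv.Perm (Fin n)) (w : Fin 4 → ℕ)
    (hw : Finset.univ.image w = Finset.Icc 1 4) :
    (⟨4, w, hw, {{0, 1}, {2, 3}}⟩ : VincularPattern).ContainedIn τ ↔
      ∃ i i' j j' : Fin n, i'.val = i.val + 1 ∧ j'.val = j.val + 1 ∧ i' < j ∧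
        ∀ r s : Fin 4, τ (![i, i', j, j'] r) < τ (![i, i', j, j'] s) ↔ w r < w s := by
  constructor
  · rintro ⟨f, hf, hadj, -, -⟩
    have hval : ∀ r : Fin 4, ![f (0 : Fin 4), f (1 : Fin 4), f (2 : Fin 4), f (3 : Fin 4)] r =
        f r := fun r => by fin_cases r <;> rfl
    refine ⟨f (0 : Fin 4), f (1 : Fin 4), f (2 : Fin 4), f (3 : Fin 4),
      hadj {0, 1} (by simp) (0 : Fin 4) (by simp) (1 : Fin 4) (by simp) rfl,
      hadj {2, 3} (by simp) (2 : Fin 4) (by simp) (3 : Fin 4) (by simp) rfl,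
      f.strictMono (show (1 : Fin 4) < 2 by decide), fun r s => ?_⟩
    rw [hval, hval]
    exact hf r s
  · rintro ⟨i, i', j, j', hi, hj, hij, h⟩
    have hmono : StrictMono ![i, i', j, j'] := by
      rw [Fin.strictMono_iff_lt_succ]
      have h1 : i < i' := Fin.lt_def.2 (by omega)
      have h2 : j < j' := Fin.lt_def.2 (by omega)
      intro k
      fin_cases k <;> simpa
    -- No bracket is a singleton, so both end conditions are vacuous.
    have hsingle : ∀ k : Fin 4,
        ¬ {k} ∈ ({{0, 1}, {2, 3}} : Finset (Finset (Fin 4))) := by decide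
    refine ⟨OrderEmbedding.ofStrictMono _ hmono, h, ?_, fun k hk => absurd hk (hsingle k),
      fun k hk => absurd hk (hsingle k)⟩
    intro B hB r hr s hs hrs
    change Fin 4 at r s
    rcases Finset.mem_insert.1 hB with rfl | hB
    · fin_cases r <;> fin_cases s <;> simp_all
    · obtain rfl := Finset.mem_singleton.1 hB
      fin_cases r <;> fin_cases s <;> simp_all

theorem containedIn_pat14_23_iff {n : ℕ} (τ : Equiv.Perm (Fin n)) :
    pat14_23.ContainedIn τ ↔ ∃ i i' j j' : Fin n, i'.val = i.val + 1 ∧ j'.val = j.val + 1 ∧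
      i' < j ∧ τ i < τ j ∧ τ j < τ j' ∧ τ j' < τ i' := by
  refine (containedIn_pairs_iff ..).trans ?_
  refine exists₄_congr fun i i' j j' => and_congr_right fun _ => and_congr_right fun _ =>
    and_congr_right fun _ => ⟨fun h => ⟨(h 0 2).2 (by decide), (h 2 3).2 (by decide),
      (h 3 1).2 (by decide)⟩, ?_⟩
  rintro ⟨h1, h2, h3⟩ r s
  fin_cases r <;> fin_cases s <;> simp <;> order

theorem containedIn_pat23_14_iff {n : ℕ} (τ : Equiv.Perm (Fin n)) :
    pat23_14.ContainedIn τ ↔ ∃ i i' j j' : Fin n, i'.val = i.val + 1 ∧ j'.val = j.val + 1 ∧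
      i' < j ∧ τ j < τ i ∧ τ i < τ i' ∧ τ i' < τ j' := by
  refine (containedIn_pairs_iff ..).trans ?_
  refine exists₄_congr fun i i' j j' => and_congr_right fun _ => and_congr_right fun _ =>
    and_congr_right fun _ => ⟨fun h => ⟨(h 2 0).2 (by decide), (h 0 1).2 (by decide),
      (h 1 3).2 (by decide)⟩, ?_⟩
  rintro ⟨h1, h2, h3⟩ r s
  fin_cases r <;> fin_cases s <;> simp <;> order

theorem containedIn_pat41_32_iff {n : ℕ} (τ : Equiv.Perm (Fin n)) :
    pat41_32.ContainedIn τ ↔ ∃ i i' j j' : Fin n, i'.val = i.val + 1 ∧ j'.val = j.val + 1 ∧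
      i' < j ∧ τ i' < τ j' ∧ τ j' < τ j ∧ τ j < τ i := by
  refine (containedIn_pairs_iff ..).trans ?_
  refine exists₄_congr fun i i' j j' => and_congr_right fun _ => and_congr_right fun _ =>
    and_congr_right fun _ => ⟨fun h => ⟨(h 1 3).2 (by decide), (h 3 2).2 (by decide),
      (h 2 0).2 (by decide)⟩, ?_⟩
  rintro ⟨h1, h2, h3⟩ r s
  fin_cases r <;> fin_cases s <;> simp <;> order

theorem containedIn_pat32_41_iff {n : ℕ} (τ : Equiv.Perm (Fin n)) :
    pat32_41.ContainedIn τ ↔ ∃ i i' j j' : Fin n, i'.val = i.val + 1 ∧ j'.val = j.val + 1 ∧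
      i' < j ∧ τ j' < τ i' ∧ τ i' < τ i ∧ τ i < τ j := by
  refine (containedIn_pairs_iff ..).trans ?_
  refine exists₄_congr fun i i' j j' => and_congr_right fun _ => and_congr_right fun _ =>
    and_congr_right fun _ => ⟨fun h => ⟨(h 3 1).2 (by decide), (h 1 0).2 (by decide),
      (h 0 2).2 (by decide)⟩, ?_⟩
  rintro ⟨h1, h2, h3⟩ r s
  fin_cases r <;> fin_cases s <;> simp <;> order

theorem containedIn_pair_last_iff (τ : Equiv.Perm (Fin (m + 1))) (w : Fin 3 → ℕ)
    (hw : Finset.univ.image w = Finset.Icc 1 3) :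
    (⟨3, w, hw, {{0, 1}, {2}}⟩ : VincularPattern).ContainedIn τ ↔
      ∃ i i' : Fin (m + 1), i'.val = i.val + 1 ∧ i' < Fin.last m ∧
        ∀ r s : Fin 3, τ (![i, i', Fin.last m] r) < τ (![i, i', Fin.last m] s) ↔
          w r < w s := by
  constructor
  · rintro ⟨f, hf, hadj, -, hend⟩
    have hlast : f (2 : Fin 3) = Fin.last m :=
      Fin.ext (Nat.succ_injective (hend (2 : Fin 3) (by simp) rfl))
    have hval : ∀ r : Fin 3, ![f (0 : Fin 3), f (1 : Fin 3), Fin.last m] r = f r := fun r => by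
      fin_cases r
      exacts [rfl, rfl, hlast.symm]
    refine ⟨f (0 : Fin 3), f (1 : Fin 3),
      hadj {0, 1} (by simp) (0 : Fin 3) (by simp) (1 : Fin 3) (by simp) rfl,
      hlast ▸ f.strictMono (show (1 : Fin 3) < 2 by decide), fun r s => ?_⟩
    rw [hval, hval]
    exact hf r s
  · rintro ⟨i, i', hi, hi', h⟩
    have hmono : StrictMono ![i, i', Fin.last m] := by
      rw [Fin.strictMono_iff_lt_succ]
      have h1 : i < i' := Fin.lt_def.2 (by omega)
      intro k
      fin_cases k <;> simpa
    have hsingle : ∀ k : Fin 3,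
        {k} ∈ ({{0, 1}, {2}} : Finset (Finset (Fin 3))) → k = 2 := by decide
    refine ⟨OrderEmbedding.ofStrictMono _ hmono, h, ?_, ?_, ?_⟩
    · intro B hB r hr s hs hrs
      change Fin 3 at r s
      rcases Finset.mem_insert.1 hB with rfl | hB
      · fin_cases r <;> fin_cases s <;> simp_all
      · obtain rfl := Finset.mem_singleton.1 hB
        fin_cases r <;> fin_cases s <;> simp_all
    · intro k hk hk0
      obtain rfl := hsingle k hk
      exact absurd hk0 (by simp)
    · intro k hk _
      obtain rfl := hsingle k hk
      rfl

theorem containedIn_pat23_1_iff (τ : Equiv.Perm (Fin (m + 1))) :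
    pat23_1.ContainedIn τ ↔ ∃ i i' : Fin (m + 1), i'.val = i.val + 1 ∧
      τ (Fin.last m) < τ i ∧ τ i < τ i' := by
  refine (containedIn_pair_last_iff ..).trans ?_
  refine exists₂_congr fun i i' => and_congr_right fun _ =>
    ⟨fun h => ⟨(h.2 2 0).2 (by decide), (h.2 0 1).2 (by decide)⟩, ?_⟩
  rintro ⟨h1, h2⟩
  -- The second entry exceeds the final one, so it cannot be in the last position.
  refine ⟨(Fin.le_last i').lt_of_ne (by rintro rfl; order), fun r s => ?_⟩
  fin_cases r <;> fin_cases s <;> simp <;> order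

/-! ### Nested arcs of a cyclic permutation and occurrences of the patterns in its image -/

theorem exists_nested_excedances_iff {π : Equiv.Perm (Fin (m + 1))} (h : Cyclic π) :
    (∃ a b, a < b ∧ b < π b ∧ π b < π a) ↔ pat14_23.ContainedIn (theta π) ∨
      pat23_14.ContainedIn (theta π) ∨ pat23_1.ContainedIn (theta π) := by
  rw [containedIn_pat14_23_iff, containedIn_pat23_14_iff, containedIn_pat23_1_iff]
  constructor
  · rintro ⟨a, b, hab, hb, hba⟩
    obtain ⟨i, rfl⟩ := (theta π).surjective a
    obtain ⟨j, rfl⟩ := (theta π).surjective b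
    -- The head of the inner arc lies below another value, so this arc is not the closing one.
    have hj : j ≠ Fin.last m := by
      rintro rfl
      rw [apply_theta_last_of_cyclic h] at hba
      exact absurd hba (not_lt.2 (Fin.le_last _))
    obtain ⟨j', hj'⟩ : ∃ j' : Fin (m + 1), j'.val = j.val + 1 :=
      ⟨⟨j.val + 1, Nat.succ_lt_succ (Fin.val_lt_last hj)⟩, rfl⟩
    rw [apply_theta_of_cyclic h hj'] at hb hba
    by_cases hi : i = Fin.last m
    · subst hi
      exact .inr (.inr ⟨j, j', hj', hab, hb⟩)
    · obtain ⟨i', hi'⟩ : ∃ i' : Fin (m + 1), i'.val = i.val + 1 :=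
        ⟨⟨i.val + 1, Nat.succ_lt_succ (Fin.val_lt_last hi)⟩, rfl⟩
      rw [apply_theta_of_cyclic h hi'] at hba
      -- A shared end would contradict the strict nesting, so the two adjacent pairs are disjoint
      -- and one precedes the other.
      have h1 : i' ≠ j := by rintro rfl; order
      have h2 : j' ≠ i := by rintro rfl; order
      have h3 : i ≠ j := by rintro rfl; order
      rcases lt_or_gt_of_ne h3 with hij | hij
      · exact .inl ⟨i, i', j, j', hi', hj', by omega, hab, hb, hba⟩
      · exact .inr (.inl ⟨j, j', i, i', hj', hi', by omega, hab, hb, hba⟩)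
  · rintro (⟨i, i', j, j', hi, hj, -, h1, h2, h3⟩ | ⟨j, j', i, i', hj, hi, -, h1, h2, h3⟩ |
      ⟨j, j', hj, h1, h2⟩)
    · refine ⟨theta π i, theta π j, h1, ?_⟩
      rw [apply_theta_of_cyclic h hi, apply_theta_of_cyclic h hj]
      exact ⟨h2, h3⟩
    · refine ⟨theta π i, theta π j, h1, ?_⟩
      rw [apply_theta_of_cyclic h hi, apply_theta_of_cyclic h hj]
      exact ⟨h2, h3⟩
    -- The outer arc is the closing one; its head is the maximum, and injectivity makes the
    -- inequality strict.
    · refine ⟨theta π (Fin.last m), theta π j, h1, ?_, lt_of_le_of_ne ?_ fun heq => ?_⟩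
      · rwa [apply_theta_of_cyclic h hj]
      · rw [apply_theta_last_of_cyclic h]
        exact Fin.le_last _
      · exact h1.ne' (π.injective heq)

theorem exists_nested_antiexcedances_iff {π : Equiv.Perm (Fin (m + 1))} (h : Cyclic π) :
    (∃ b c, b < c ∧ π b < b ∧ π c < π b) ↔ pat41_32.ContainedIn (theta π) ∨
      pat32_41.ContainedIn (theta π) := by
  rw [containedIn_pat41_32_iff, containedIn_pat32_41_iff]
  constructor
  · rintro ⟨b, c, hbc, hb, hcb⟩
    obtain ⟨i, rfl⟩ := (theta π).surjective b
    obtain ⟨j, rfl⟩ := (theta π).surjective c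
    -- Both heads lie below the maximum, so neither arc is the closing one; hence no pattern of
    -- length 3 arises here.
    have hne : ∀ k, π (theta π k) < Fin.last m → k ≠ Fin.last m := by
      rintro k hk rfl
      rw [apply_theta_last_of_cyclic h] at hk
      exact lt_irrefl _ hk
    have hi := hne i (hb.trans_le (Fin.le_last _))
    have hj := hne j (hcb.trans_le (Fin.le_last _))
    obtain ⟨i', hi'⟩ : ∃ i' : Fin (m + 1), i'.val = i.val + 1 :=
      ⟨⟨i.val + 1, Nat.succ_lt_succ (Fin.val_lt_last hi)⟩, rfl⟩
    obtain ⟨j', hj'⟩ : ∃ j' : Fin (m + 1), j'.val = j.val + 1 :=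
      ⟨⟨j.val + 1, Nat.succ_lt_succ (Fin.val_lt_last hj)⟩, rfl⟩
    rw [apply_theta_of_cyclic h hi'] at hb hcb
    rw [apply_theta_of_cyclic h hj'] at hcb
    have h1 : i' ≠ j := by rintro rfl; order
    have h2 : j' ≠ i := by rintro rfl; order
    have h3 : i ≠ j := by rintro rfl; order
    rcases lt_or_gt_of_ne h3 with hij | hij
    · exact .inr ⟨i, i', j, j', hi', hj', by omega, hcb, hb, hbc⟩
    · exact .inl ⟨j, j', i, i', hj', hi', by omega, hcb, hb, hbc⟩
  · rintro (⟨j, j', i, i', hj, hi, -, h1, h2, h3⟩ | ⟨i, i', j, j', hi, hj, -, h1, h2, h3⟩) <;>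
    · refine ⟨theta π i, theta π j, h3, ?_⟩
      rw [apply_theta_of_cyclic h hi, apply_theta_of_cyclic h hj]
      exact ⟨h2, h1⟩

theorem avoidsClassical_321_iff_of_cyclic {π : Equiv.Perm (Fin (m + 1))} (h : Cyclic π) :
    AvoidsClassical π ![3, 2, 1] ↔ ∀ p ∈ fivePatterns, ¬ p.ContainedIn (theta π) := by
  rw [AvoidsClassical, orderIsomorphicAt_321_iff, exists_321_iff_of_cyclic h,
    exists_nested_excedances_iff h, exists_nested_antiexcedances_iff h]
  simp only [fivePatterns, Set.mem_insert_iff, Set.mem_singleton_iff, forall_eq_or_imp, forall_eq]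
  tauto

end CyclicAvoidance

theorem theorem3p1 (n : ℕ) (hn : 1 ≤ n) :
    (∀ π : Equiv.Perm (Fin n),
      (CyclicAvoidance.Cyclic π ∧ CyclicAvoidance.AvoidsClassical π ![3, 2, 1]) ↔
        (CyclicAvoidance.StartsWith (CyclicAvoidance.theta π) n ∧
          ∀ p ∈ CyclicAvoidance.fivePatterns, ¬ p.ContainedIn (CyclicAvoidance.theta π))) ∧
    CyclicAvoidance.cyclicAvoiders n ![3, 2, 1] =
      CyclicAvoidance.theta ⁻¹'
        CyclicAvoidance.startingAvoiders n n CyclicAvoidance.fivePatterns := by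
  have key : ∀ π : Equiv.Perm (Fin n),
      (CyclicAvoidance.Cyclic π ∧ CyclicAvoidance.AvoidsClassical π ![3, 2, 1]) ↔
        (CyclicAvoidance.StartsWith (CyclicAvoidance.theta π) n ∧
          ∀ p ∈ CyclicAvoidance.fivePatterns, ¬ p.ContainedIn (CyclicAvoidance.theta π)) := by
    obtain ⟨m, rfl⟩ := Nat.exists_eq_add_of_le' hn
    intro π
    rw [CyclicAvoidance.startsWith_theta_iff]
    exact and_congr_right CyclicAvoidance.avoidsClassical_321_iff_of_cyclic
  exact ⟨key, Set.ext key⟩
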